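/- Let $\mathcal A$ be a finite indexed collection of $n$ distinct linear hyperplanes in $\mathbb R^d$, each with a chosen positive side, that is centrally simple: for $0\le k\le d$, any $k$ of the hyperplanes intersect in a subspace of dimension $d-k$. For a central arrangement $\mathcal B$ let $\mathcal T(\mathcal B)$ be the set of its topes, that is, the connected components of the complement of the union of its hyperplanes. The odd-even invariant of $\mathcal B$ is $$\Bigl|\sum_{T\in\mathcal T(\mathcal B)}(-1)^{\sigma(T)}\Bigr|,$$ where $\sigma(T)$ is the number of hyperplanes of $\mathcal B$ whose open positive side contains $T$. The tope graph of $\mathcal B$ has vertex set $\mathcal T(\mathcal B)$, two distinct topes being adjacent if the intersection of their closures is a facet of each. For $H\in\mathcal A$ let $\mathcal A\setminus\{H\}$ be the arrangement in $\mathbb R^d$ with $H$ deleted, and let $\mathcal A/\{H\}$ be the arrangement in the $(d-1)$-dimensional space $H$ formed by the intersections $H'\cap H$ with $H'\in\mathcal A\setminus\{H\}$, indexed by $\mathcal A\setminus\{H\}$. Suppose that $\mathcal A$ includes a hyperplane $H$ such that the odd-even invariant of $\mathcal A\setminus\{H\}$ is greater than $2\,|\mathcal T(\mathcal A/\{H\})|$.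 Then the tope graph of $\mathcal A$ has no perfect matching. -/

import Mathlib

/-- A central arrangement of hyperplanes, indexed by `ι`, in the real vector space `V`, with a
positive and a negative side specified for every hyperplane. The `i`-th hyperplane is the kernel
of the nonzero linear form `form i`, and its positive side is where that form is positive. -/
structure CentralArrangement (ι V : Type*) [AddCommGroup V] [Module ℝ V] where
  /-- The linear form whose kernel is the `i`-th hyperplane. -/
  form : ι → Module.Dual ℝ V
  form_ne_zero : ∀ i, form i ≠ 0

/-- `F` is a facet of the (full-dimensional) closed convex polyhedron `P`: a nonempty face of `P`,
cut out by a supporting linear form, whose affine span has codimension one. -/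
def IsPolyhedronFacet {V : Type*} [NormedAddCommGroup V] [NormedSpace ℝ V] (P F : Set V) : Prop :=
  F.Nonempty ∧ IsExposed ℝ P F ∧
    Module.finrank ℝ (vectorSpan ℝ F) + 1 = Module.finrank ℝ V

namespace CentralArrangement

section Algebra

variable {ι V : Type*} [AddCommGroup V] [Module ℝ V]

/-- The `i`-th hyperplane. -/
def hyperplane (A : CentralArrangement ι V) (i : ι) : Submodule ℝ V :=
  LinearMap.ker (A.form i)

/-- The open half-space on the positive side of the `i`-th hyperplane. -/
def posSide (A : CentralArrangement ι V) (i : ι) : Set V := {x | 0 < A.form i x}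

/-- The complement of the union of the hyperplanes. -/
def complement (A : CentralArrangement ι V) : Set V := {x | ∀ i, x ∉ A.hyperplane i}

/-- The hyperplanes of the arrangement are pairwise distinct. -/
def IsDistinct (A : CentralArrangement ι V) : Prop := Function.Injective A.hyperplane

/-- Central simplicity (linear general position): for `k ≤ dim V`, any `k` of the hyperplanes
intersect in a subspace of dimension `dim V - k`. -/
def IsCentrallySimple (A : CentralArrangement ι V) : Prop :=
  ∀ s : Finset ι, s.card ≤ Module.finrank ℝ V →
    Module.finrank ℝ (⨅ j ∈ s, A.hyperplane j : Submodule ℝ V) = Module.finrank ℝ V - s.card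

/-- The deletion of the `i`-th hyperplane. -/
def deletion (A : CentralArrangement ι V) (i : ι) : CentralArrangement {j : ι // j ≠ i} V where
  form j := A.form j
  form_ne_zero j := A.form_ne_zero j

theorem domRestrict_ne_zero (A : CentralArrangement ι V) (hA : A.IsDistinct) {i j : ι}
    (hji : j ≠ i) : (A.form j).domRestrict (A.hyperplane i) ≠ 0 := by
  intro h
  have hle : LinearMap.ker (A.form i) ≤ LinearMap.ker (A.form j) := fun x hx => by
    have := LinearMap.congr_fun h ⟨x, hx⟩
    simpa using this
  have hi : IsCoatom (LinearMap.ker (A.form i)) :=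
    LinearMap.isCoatom_ker_of_surjective (LinearMap.surjective (A.form_ne_zero i))
  rcases hi.le_iff.mp hle with h' | h'
  · exact A.form_ne_zero j (LinearMap.ker_eq_top.mp h')
  · exact hji (hA h')

/-- The restriction of an arrangement of distinct hyperplanes to its `i`-th hyperplane `H`: the
arrangement, in the vector space `H`, of the intersections `H' ∩ H` with `H'` one of the other
hyperplanes. -/
def restriction (A : CentralArrangement ι V) (hA : A.IsDistinct) (i : ι) :
    CentralArrangement {j : ι // j ≠ i} (A.hyperplane i) where
  form j := (A.form j).domRestrict (A.hyperplane i)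
  form_ne_zero j := A.domRestrict_ne_zero hA j.2

/-- The hyperplanes of the restriction are the intersections `H' ∩ H`, seen inside `H`. -/
theorem restriction_hyperplane (A : CentralArrangement ι V) (hA : A.IsDistinct) (i : ι)
    (j : {j : ι // j ≠ i}) :
    ((A.restriction hA i).hyperplane j).map (A.hyperplane i).subtype =
      A.hyperplane j ⊓ A.hyperplane i := by
  ext x
  constructor
  · rintro ⟨y, hy, rfl⟩
    exact ⟨hy, y.2⟩
  · rintro ⟨h1, h2⟩
    exact ⟨⟨x, h2⟩, h1, rfl⟩

end Algebra

section Topes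

variable {ι V : Type*} [NormedAddCommGroup V] [NormedSpace ℝ V]

/-- The topes: the connected components of the complement of the union of the hyperplanes. -/
def topes (A : CentralArrangement ι V) : Set (Set V) :=
  {T | ∃ x ∈ A.complement, T = connectedComponentIn A.complement x}

theorem topes_finite [Finite ι] (A : CentralArrangement ι V) : A.topes.Finite := by
  classical
  -- two points of the complement with the same signs lie in the same component
  have key : ∀ x ∈ A.complement, ∀ y ∈ A.complement,
      {i | 0 < A.form i x} = {i | 0 < A.form i y} →
      connectedComponentIn A.complement x = connectedComponentIn A.complement y := by
    intro x hx y hy hxy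
    have hseg : segment ℝ x y ⊆ A.complement := by
      rintro z ⟨a, b, ha, hb, hab, rfl⟩ i hi
      have hx' : A.form i x ≠ 0 := hx i
      have hy' : A.form i y ≠ 0 := hy i
      have hiff : 0 < A.form i x ↔ 0 < A.form i y := by
        have := Set.ext_iff.mp hxy i
        simpa using this
      have h0 : a * A.form i x + b * A.form i y = 0 := by
        have : A.form i (a • x + b • y) = 0 := hi
        simpa using this
      rcases lt_or_gt_of_ne hx' with h1 | h1
      · have h2 : A.form i y < 0 :=
          lt_of_le_of_ne (not_lt.mp fun h => absurd (hiff.mpr h) (not_lt.mpr h1.le)) hy'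
        rcases ha.eq_or_lt with rfl | ha'
        · have : b = 1 := by linarith
          subst this
          linarith
        · nlinarith [mul_neg_of_pos_of_neg ha' h1, mul_nonneg hb (neg_pos.mpr h2).le]
      · have h2 := hiff.mp h1
        rcases ha.eq_or_lt with rfl | ha'
        · have : b = 1 := by linarith
          subst this
          linarith
        · nlinarith [mul_pos ha' h1, mul_nonneg hb h2.le]
    have := (convex_segment (𝕜 := ℝ) x y).isPreconnected.subset_connectedComponentIn
      (left_mem_segment ℝ x y) hseg
    exact connectedComponentIn_eq (this (right_mem_segment ℝ x y))
  let g : Set ι → Set V := fun s =>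
    if h : ∃ x ∈ A.complement, {i | 0 < A.form i x} = s then
      connectedComponentIn A.complement h.choose else ∅
  refine (Set.finite_range g).subset ?_
  rintro T ⟨x, hx, rfl⟩
  have h : ∃ z ∈ A.complement, {i | 0 < A.form i z} = {i | 0 < A.form i x} := ⟨x, hx, rfl⟩
  refine ⟨{i | 0 < A.form i x}, ?_⟩
  simp only [g, dif_pos h]
  exact key _ h.choose_spec.1 _ hx h.choose_spec.2

/-- The number of hyperplanes whose positive side contains `T`. -/
noncomputable def positiveCount (A : CentralArrangement ι V) (T : Set V) : ℕ :=
  {i | T ⊆ A.posSide i}.ncard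

/-- The signed odd-even invariant. -/
noncomputable def signedOddEvenInvariant [Finite ι] (A : CentralArrangement ι V) : ℤ :=
  ∑ T ∈ A.topes_finite.toFinset, (-1 : ℤ) ^ A.positiveCount T

/-- The odd-even invariant. -/
noncomputable def oddEvenInvariant [Finite ι] (A : CentralArrangement ι V) : ℤ :=
  |A.signedOddEvenInvariant|

/-- The tope graph: two distinct topes are adjacent if the intersection of their closures is a
facet of (the closure of) each. -/
def topeGraph (A : CentralArrangement ι V) : SimpleGraph A.topes where
  Adj S T := S ≠ T ∧
    IsPolyhedronFacet (closure (S : Set V)) (closure (S : Set V) ∩ closure (T : Set V)) ∧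
    IsPolyhedronFacet (closure (T : Set V)) (closure (S : Set V) ∩ closure (T : Set V))
  symm := ⟨fun S T h => ⟨h.1.symm, by rw [Set.inter_comm]; exact h.2.2,
    by rw [Set.inter_comm]; exact h.2.1⟩⟩
  loopless := ⟨fun _ h => h.1 rfl⟩

end Topes

end CentralArrangement

/-! Identify each tope with the set of hyperplanes on whose positive side it lies. Forgetting `H`
maps the topes of the arrangement onto those of the deletion; a tope of the deletion has one
preimage, or two on opposite sides of `H`, and those with two correspond to the topes of the
restriction.

Matched topes are separated by exactly one hyperplane. If it is not `H`, their signs in the deletion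
are opposite and cancel; if it is `H`, they have the same image. Let `I` be the set of images with
two preimages and `L ⊆ I` those whose preimages are matched to each other. Summing deletion signs
over all topes of the arrangement gives `2 Σ_L` by matching, and the sum over the deletion plus
`Σ_I` by counting preimages. Hence the signed invariant of the deletion is `Σ_L - Σ_{I \ L}`, at
most `|I|` in absolute value. This is already stronger than the bound `2 |I|` that is needed. -/

open Finset in
/-- If `f` is a fixed-point-free involution along which either `w ∘ res` changes sign or
`res` is preserved, then the `w`-weight of the image of `res` is at most the number of values that
`res` takes on both sides. -/
theorem abs_sum_union_image_le_card_inter_image {α β : Type*} [Fintype α] [DecidableEq α]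
    [DecidableEq β] (side : α → Prop) [DecidablePred side] (res : α → β)
    (hinj : ∀ s t, res s = res t → (side s ↔ side t) → s = t)
    (w : β → ℤ) (hw : ∀ t, |w t| ≤ 1) (f : α → α) (hff : ∀ s, f (f s) = s) (hne : ∀ s, f s ≠ s)
    (hf : ∀ s, res (f s) = res s ∨ w (res (f s)) = - w (res s)) :
    |∑ t ∈ ({s | side s} : Finset α).image res ∪ ({s | ¬ side s} : Finset α).image res, w t| ≤
      #(({s | side s} : Finset α).image res ∩ ({s | ¬ side s} : Finset α).image res) := by
  set Pp := ({s | side s} : Finset α) with hPp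
  set Pm := ({s | ¬ side s} : Finset α) with hPm
  have hsidef : ∀ s, res (f s) = res s → (side (f s) ↔ ¬ side s) := fun s hs => by
    have := fun h => hne s (hinj _ _ hs h)
    tauto
  have hsum : ∀ (p : α → Prop) [DecidablePred p] (b : Prop) (_ : ∀ s, p s → (side s ↔ b)),
      ∑ t ∈ ({s | p s} : Finset α).image res, w t = ∑ s with p s, w (res s) := by
    intro p _ b hb
    refine sum_image fun s hs t ht hst => hinj s t hst ?_
    rw [hb s (by simpa using hs), hb t (by simpa using ht)]
  have hp : ∑ t ∈ Pp.image res, w t = ∑ s with side s, w (res s) :=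
    hsum side True (by simp)
  have hm : ∑ t ∈ Pm.image res, w t = ∑ s with ¬ side s, w (res s) :=
    hsum (fun s => ¬ side s) False (by simp)
  -- Values coming from pairs that `f` matches across the two sides. Each is attained once per side,
  -- whence the factor 2 in `htotal`.
  set L := ({s | res (f s) = res s ∧ side s} : Finset α).image res with hL
  have hL' : L = ({s | res (f s) = res s ∧ ¬ side s} : Finset α).image res := by
    ext t
    simp only [hL, mem_image, mem_filter, mem_univ, true_and]
    constructor
    · rintro ⟨s, ⟨h1, h2⟩, rfl⟩
      exact ⟨f s, ⟨by rw [hff, h1], by rw [hsidef s h1]; simpa using h2⟩, h1⟩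
    · rintro ⟨s, ⟨h1, h2⟩, rfl⟩
      exact ⟨f s, ⟨by rw [hff, h1], by rw [hsidef s h1]; exact h2⟩, h1⟩
  have hLR : L ⊆ Pp.image res ∩ Pm.image res := by
    refine subset_inter ?_ ?_
    · exact image_subset_image fun s hs => by simp_all
    · rw [hL']
      exact image_subset_image fun s hs => by simp_all
  have hLp : ∑ t ∈ L, w t = ∑ s with res (f s) = res s ∧ side s, w (res s) :=
    hsum _ True (by simp)
  have hLm : ∑ t ∈ L, w t = ∑ s with res (f s) = res s ∧ ¬ side s, w (res s) := by
    rw [hL']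
    exact hsum _ False (by simp)
  have hzero : ∑ s with ¬ res (f s) = res s, w (res s) = 0 := by
    refine sum_involution (fun s _ => f s) ?_ (fun s _ _ => hne s) ?_ (fun s _ => hff s)
    · intro s hs
      rw [mem_filter] at hs
      rw [(hf s).resolve_left hs.2, add_neg_cancel]
    · intro s hs
      rw [mem_filter] at hs ⊢
      exact ⟨mem_univ _, by rw [hff]; exact fun h => hs.2 h.symm⟩
  have htotal : ∑ s, w (res s) = 2 * ∑ t ∈ L, w t := by
    rw [← sum_filter_add_sum_filter_not univ (fun s => res (f s) = res s), hzero, add_zero,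
      ← sum_filter_add_sum_filter_not _ side, filter_filter, filter_filter, ← hLp, ← hLm]
    ring
  -- Inclusion-exclusion turns `htotal` into: the sum over the union is the sum over `L` minus the
  -- sum over the rest of the intersection.
  have hUI := sum_union_inter (s₁ := Pp.image res) (s₂ := Pm.image res) (f := w)
  rw [hp, hm, sum_filter_add_sum_filter_not univ side, htotal, ← sum_sdiff hLR] at hUI
  have hbound : ∀ S : Finset β, |∑ t ∈ S, w t| ≤ #S := fun S =>
    (abs_sum_le_sum_abs _ _).trans ((sum_le_sum fun t _ => hw t).trans (by simp))
  have hcard := card_sdiff_add_card_eq_card hLR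
  have h1 := hbound L
  have h2 := hbound ((Pp.image res ∩ Pm.image res) \ L)
  rw [abs_le] at *
  constructor <;> · push_cast [← hcard]; linarith

namespace CentralArrangement

variable {ι V : Type*} [NormedAddCommGroup V] [NormedSpace ℝ V]

/-! ### Topes as sign sets -/

/-- The indices of the hyperplanes whose positive side contains `T`. -/
def posIndex (A : CentralArrangement ι V) (T : Set V) : Set ι := {i | T ⊆ A.posSide i}

theorem form_combination_pos_iff (A : CentralArrangement ι V) {x y : V} {i : ι}
    (hx : A.form i x ≠ 0) (hy : A.form i y ≠ 0) (hxy : 0 < A.form i x ↔ 0 < A.form i y)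
    {a b : ℝ} (ha : 0 ≤ a) (hb : 0 ≤ b) (hab : a + b = 1) :
    A.form i (a • x + b • y) ≠ 0 ∧ (0 < A.form i (a • x + b • y) ↔ 0 < A.form i x) := by
  simp only [map_add, map_smul, smul_eq_mul]
  rcases lt_or_gt_of_ne hx with h1 | h1
  · have h2 : A.form i y < 0 :=
      lt_of_le_of_ne (not_lt.mp fun h => absurd (hxy.mpr h) (not_lt.mpr h1.le)) hy
    have : a * A.form i x + b * A.form i y < 0 := by
      rcases ha.eq_or_lt with rfl | ha'
      · obtain rfl : b = 1 := by linarith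
        linarith
      · nlinarith [mul_neg_of_pos_of_neg ha' h1, mul_nonneg hb (neg_pos.mpr h2).le]
    exact ⟨this.ne, iff_of_false this.not_gt h1.not_gt⟩
  · have h2 := hxy.mp h1
    have : 0 < a * A.form i x + b * A.form i y := by
      rcases ha.eq_or_lt with rfl | ha'
      · obtain rfl : b = 1 := by linarith
        linarith
      · nlinarith [mul_pos ha' h1, mul_nonneg hb h2.le]
    exact ⟨this.ne', iff_of_true this h1⟩

theorem connectedComponentIn_complement_eq (A : CentralArrangement ι V) {x y : V}
    (hx : x ∈ A.complement) (hy : y ∈ A.complement)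
    (hxy : ∀ i, 0 < A.form i x ↔ 0 < A.form i y) :
    connectedComponentIn A.complement x = connectedComponentIn A.complement y := by
  have hseg : segment ℝ x y ⊆ A.complement := by
    rintro z ⟨a, b, ha, hb, hab, rfl⟩ i hi
    exact (A.form_combination_pos_iff (hx i) (hy i) (hxy i) ha hb hab).1 hi
  have := (convex_segment (𝕜 := ℝ) x y).isPreconnected.subset_connectedComponentIn
    (left_mem_segment ℝ x y) hseg
  exact connectedComponentIn_eq (this (right_mem_segment ℝ x y))

/-- By the intermediate value theorem, a form that changed sign on a component would vanish there.
-/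
theorem form_pos_iff_of_mem_connectedComponentIn [FiniteDimensional ℝ V]
    (A : CentralArrangement ι V) {x y : V}
    (hy : y ∈ connectedComponentIn A.complement x) (i : ι) :
    0 < A.form i y ↔ 0 < A.form i x := by
  have hx : x ∈ A.complement := by
    by_contra h
    rw [connectedComponentIn_eq_empty h] at hy
    exact hy
  have hcont : ContinuousOn (A.form i) (connectedComponentIn A.complement x) :=
    (A.form i).continuous_of_finiteDimensional.continuousOn
  have hx' := mem_connectedComponentIn hx
  have hne : ∀ z ∈ connectedComponentIn A.complement x, A.form i z ≠ 0 :=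
    fun z hz => connectedComponentIn_subset _ _ hz i
  have key : ∀ u ∈ connectedComponentIn A.complement x,
      ∀ v ∈ connectedComponentIn A.complement x, 0 < A.form i u → 0 < A.form i v := by
    intro u hu v hv hpos
    by_contra hneg
    obtain ⟨z, hz, hz0⟩ := isPreconnected_connectedComponentIn.intermediate_value hv hu hcont
      ⟨not_lt.mp hneg, hpos.le⟩
    exact hne z hz hz0
  exact ⟨key y hy x hx', key x hx' y hy⟩

theorem posIndex_connectedComponentIn [FiniteDimensional ℝ V]
    (A : CentralArrangement ι V) {x : V} (hx : x ∈ A.complement) :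
    A.posIndex (connectedComponentIn A.complement x) = {i | 0 < A.form i x} := by
  ext i
  exact ⟨fun h => h (mem_connectedComponentIn hx),
    fun h y hy => (A.form_pos_iff_of_mem_connectedComponentIn hy i).mpr h⟩

theorem injOn_posIndex [FiniteDimensional ℝ V] (A : CentralArrangement ι V) :
    Set.InjOn A.posIndex A.topes := by
  rintro _ ⟨x, hx, rfl⟩ _ ⟨y, hy, rfl⟩ h
  rw [A.posIndex_connectedComponentIn hx, A.posIndex_connectedComponentIn hy] at h
  exact A.connectedComponentIn_complement_eq hx hy fun i => Set.ext_iff.mp h i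

/-- Reduces questions about topes to which sign sets are realized by points of the complement. -/
theorem mem_image_posIndex [FiniteDimensional ℝ V] (A : CentralArrangement ι V) {t : Set ι} :
    t ∈ A.posIndex '' A.topes ↔ ∃ x ∈ A.complement, {i | 0 < A.form i x} = t := by
  constructor
  · rintro ⟨_, ⟨x, hx, rfl⟩, rfl⟩
    exact ⟨x, hx, (A.posIndex_connectedComponentIn hx).symm⟩
  · rintro ⟨x, hx, rfl⟩
    exact ⟨_, ⟨x, hx, rfl⟩, A.posIndex_connectedComponentIn hx⟩

/-- A point of a tope is moved off the hyperplane of any further form, to either side, without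
changing the signs of the arrangement. -/
theorem exists_perturbation [Finite ι] (A : CentralArrangement ι V) {x : V} (hx : x ∈ A.complement)
    (v : V) :
    ∃ ε > (0 : ℝ), ∀ i, A.form i (x + ε • v) ≠ 0 ∧
      (0 < A.form i (x + ε • v) ↔ 0 < A.form i x) := by
  have key : ∀ i, ∀ᶠ ε in nhdsWithin (0 : ℝ) (Set.Ioi 0), A.form i (x + ε • v) ≠ 0 ∧
      (0 < A.form i (x + ε • v) ↔ 0 < A.form i x) := by
    intro i
    have hc : Filter.Tendsto (fun ε : ℝ => A.form i x + ε * A.form i v)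
        (nhdsWithin (0 : ℝ) (Set.Ioi 0)) (nhds (A.form i x)) := by
      have : Continuous fun ε : ℝ => A.form i x + ε * A.form i v := by fun_prop
      simpa using (this.tendsto 0).mono_left nhdsWithin_le_nhds
    simp only [map_add, map_smul, smul_eq_mul]
    rcases lt_or_gt_of_ne (show A.form i x ≠ 0 from hx i) with h | h
    · filter_upwards [hc.eventually_lt_const h] with ε hε
      exact ⟨hε.ne, iff_of_false hε.not_gt h.not_gt⟩
    · filter_upwards [hc.eventually_const_lt h] with ε hε
      exact ⟨hε.ne', iff_of_true hε h⟩
  obtain ⟨ε, h1, h2⟩ := ((Filter.eventually_all.mpr key).and self_mem_nhdsWithin).exists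
  exact ⟨ε, h2, h1⟩

theorem exists_form_eq_one (A : CentralArrangement ι V) (i : ι) : ∃ v, A.form i v = 1 :=
  LinearMap.surjective (A.form_ne_zero i) 1

/-! ### Sign sets of the deletion and the restriction -/

/-- The sign sets of the deletion, and how they lift to the arrangement. -/
theorem mem_image_posIndex_deletion [Finite ι] [FiniteDimensional ℝ V]
    (A : CentralArrangement ι V) (i : ι) {t : Set {j : ι // j ≠ i}} :
    t ∈ (A.deletion i).posIndex '' (A.deletion i).topes ↔
      ∃ T ∈ A.topes, (A.deletion i).posIndex T = t := by
  rw [mem_image_posIndex]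
  constructor
  · rintro ⟨x, hx, rfl⟩
    obtain ⟨y, hy, hi⟩ : ∃ y, (∀ j, (A.deletion i).form j y ≠ 0 ∧
        (0 < (A.deletion i).form j y ↔ 0 < (A.deletion i).form j x)) ∧ A.form i y ≠ 0 := by
      -- A point of the deletion's complement may lie on the deleted hyperplane; it is then pushed
      -- off.
      by_cases h : A.form i x = 0
      · obtain ⟨v, hv⟩ := A.exists_form_eq_one i
        obtain ⟨ε, hε, H⟩ := (A.deletion i).exists_perturbation hx v
        exact ⟨_, H, by simp [h, hv, hε.ne']⟩
      · exact ⟨x, fun j => ⟨hx j, Iff.rfl⟩, h⟩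
    have hyc : y ∈ A.complement := by
      intro j hj
      by_cases hji : j = i
      · subst hji
        exact hi hj
      · exact (hy ⟨j, hji⟩).1 hj
    refine ⟨_, ⟨y, hyc, rfl⟩, Set.ext fun j => ?_⟩
    exact (Set.ext_iff.mp (A.posIndex_connectedComponentIn hyc) j.1).trans (hy j).2
  · rintro ⟨_, ⟨x, hx, rfl⟩, rfl⟩
    refine ⟨x, fun j => hx j, Set.ext fun j => ?_⟩
    exact (Set.ext_iff.mp (A.posIndex_connectedComponentIn hx) j.1).symm

/-- The sign sets of the restriction are those that lift to topes on both sides. -/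
theorem mem_image_posIndex_restriction [Finite ι] [FiniteDimensional ℝ V]
    (A : CentralArrangement ι V) (hA : A.IsDistinct) (i : ι) {t : Set {j : ι // j ≠ i}} :
    t ∈ (A.restriction hA i).posIndex '' (A.restriction hA i).topes ↔
      (∃ T ∈ A.topes, i ∈ A.posIndex T ∧ (A.deletion i).posIndex T = t) ∧
      (∃ T ∈ A.topes, i ∉ A.posIndex T ∧ (A.deletion i).posIndex T = t) := by
  rw [mem_image_posIndex]
  constructor
  · rintro ⟨x, hx, rfl⟩
    have hx0 : A.form i x = 0 := x.2
    have hxd : (x : V) ∈ (A.deletion i).complement := fun j => hx j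
    have key : ∀ v : V, A.form i v ≠ 0 → ∃ T ∈ A.topes, (i ∈ A.posIndex T ↔ 0 < A.form i v) ∧
        (A.deletion i).posIndex T = {j | 0 < (A.restriction hA i).form j x} := by
      intro v hv
      obtain ⟨ε, hε, H⟩ := (A.deletion i).exists_perturbation hxd v
      have hyc : (x : V) + ε • v ∈ A.complement := by
        intro j hj
        by_cases hji : j = i
        · subst hji
          have hj' : A.form j ((x : V) + ε • v) = 0 := hj
          simp [hx0, hv, hε.ne'] at hj'
        · exact (H ⟨j, hji⟩).1 hj
      refine ⟨_, ⟨_, hyc, rfl⟩, ?_, Set.ext fun j => ?_⟩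
      · rw [A.posIndex_connectedComponentIn hyc]
        simp [hx0, hε]
      · exact (Set.ext_iff.mp (A.posIndex_connectedComponentIn hyc) j.1).trans (H j).2
    obtain ⟨v, hv⟩ := A.exists_form_eq_one i
    obtain ⟨T, hT, h1, h2⟩ := key v (by simp [hv])
    obtain ⟨T', hT', h1', h2'⟩ := key (-v) (by simp [hv])
    exact ⟨⟨T, hT, h1.mpr (by simp [hv]), h2⟩, ⟨T', hT', by rw [h1']; simp [hv], h2'⟩⟩
  · rintro ⟨⟨_, ⟨x, hx, rfl⟩, hxi, rfl⟩, ⟨_, ⟨y, hy, rfl⟩, hyi, hxy⟩⟩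
    rw [A.posIndex_connectedComponentIn hx] at hxi
    rw [A.posIndex_connectedComponentIn hy] at hyi
    have hxp : 0 < A.form i x := hxi
    have hyn : A.form i y < 0 := lt_of_le_of_ne (not_lt.mp hyi) (hy i)
    have hsign : ∀ j : {j : ι // j ≠ i}, 0 < A.form j x ↔ 0 < A.form j y := by
      intro j
      have h1 := Set.ext_iff.mp (A.posIndex_connectedComponentIn hx) j.1
      have h2 := Set.ext_iff.mp (A.posIndex_connectedComponentIn hy) j.1
      exact h1.symm.trans ((Set.ext_iff.mp hxy j).symm.trans h2)
    -- The weights below give the point where the segment from `x` to `y` crosses the `i`-th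
    -- hyperplane.
    set c := A.form i x - A.form i y with hc
    have hc0 : 0 < c := by linarith
    have H : ∀ j : {j : ι // j ≠ i}, _ := fun j =>
      A.form_combination_pos_iff (hx j) (hy j) (hsign j)
        (a := -A.form i y / c) (b := A.form i x / c) (div_nonneg (by linarith) hc0.le) (by positivity)
        (by field_simp; linarith)
    refine ⟨⟨(-A.form i y / c) • x + (A.form i x / c) • y, ?_⟩, fun j => (H j).1,
      Set.ext fun j => ?_⟩
    · change A.form i _ = 0
      simp only [map_add, map_smul, smul_eq_mul]
      ring
    · exact (H j).2.trans (Set.ext_iff.mp (A.posIndex_connectedComponentIn hx) j.1).symm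

/-! ### Adjacency and the matching bound -/

/-- Adjacent topes are separated by exactly one hyperplane. -/
theorem exists_separating_of_adj [FiniteDimensional ℝ V] (A : CentralArrangement ι V)
    (hA : A.IsDistinct) {S T : A.topes} (h : A.topeGraph.Adj S T) :
    ∃ j, ¬ (j ∈ A.posIndex S ↔ j ∈ A.posIndex T) ∧
      ∀ k, k ≠ j → (k ∈ A.posIndex S ↔ k ∈ A.posIndex T) := by
  obtain ⟨hne, ⟨hnon, -, hrank⟩, -⟩ := h
  have hnonneg : ∀ (U : A.topes) (k : ι), k ∈ A.posIndex U →
      ∀ x ∈ closure (U : Set V), 0 ≤ A.form k x := by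
    intro U k hk x hx
    have hcl : IsClosed {x | 0 ≤ A.form k x} :=
      isClosed_le continuous_const (A.form k).continuous_of_finiteDimensional
    refine closure_minimal (fun y hy => ?_) hcl hx
    have hpos : 0 < A.form k y := hk hy
    exact hpos.le
  have hnonpos : ∀ (U : A.topes) (k : ι), k ∉ A.posIndex U →
      ∀ x ∈ closure (U : Set V), A.form k x ≤ 0 := by
    rintro ⟨_, y, hy, rfl⟩ k hk x hx
    rw [A.posIndex_connectedComponentIn hy] at hk
    have hcl : IsClosed {x | A.form k x ≤ 0} :=
      isClosed_le (A.form k).continuous_of_finiteDimensional continuous_const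
    refine closure_minimal (fun z hz => ?_) hcl hx
    exact not_lt.mp fun h => hk ((A.form_pos_iff_of_mem_connectedComponentIn hz k).mp h)
  -- The common facet lies in every separating hyperplane and has codimension one, so its span is
  -- that hyperplane. Two separating hyperplanes therefore coincide, and distinctness makes the
  -- index unique.
  have hspan : ∀ k, ¬ (k ∈ A.posIndex S ↔ k ∈ A.posIndex T) →
      vectorSpan ℝ (closure (S : Set V) ∩ closure (T : Set V)) = A.hyperplane k := by
    intro k hk
    have hzero : ∀ x ∈ closure (S : Set V) ∩ closure (T : Set V), A.form k x = 0 := by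
      rintro x ⟨hxS, hxT⟩
      by_cases hS : k ∈ A.posIndex S
      · have hT : k ∉ A.posIndex T := by tauto
        exact le_antisymm (hnonpos T k hT x hxT) (hnonneg S k hS x hxS)
      · have hT : k ∈ A.posIndex T := by tauto
        exact le_antisymm (hnonpos S k hS x hxS) (hnonneg T k hT x hxT)
    refine Submodule.eq_of_le_of_finrank_eq ?_ ?_
    · rw [vectorSpan_def, Submodule.span_le]
      rintro _ ⟨x, hx, y, hy, rfl⟩
      change A.form k (x - y) = 0
      rw [map_sub, hzero x hx, hzero y hy, sub_zero]
    · have := Module.Dual.finrank_ker_add_one_of_ne_zero (A.form_ne_zero k)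
      change _ = Module.finrank ℝ (LinearMap.ker (A.form k))
      omega
  have hex : ∃ j, ¬ (j ∈ A.posIndex S ↔ j ∈ A.posIndex T) := by
    by_contra! hall
    exact hne (Subtype.ext (A.injOn_posIndex S.2 T.2 (Set.ext hall)))
  obtain ⟨j, hj⟩ := hex
  refine ⟨j, hj, fun k hk => ?_⟩
  by_contra hk'
  exact hk (hA ((hspan k hk').symm.trans (hspan j hj)))

theorem neg_one_pow_ncard_eq_neg {κ : Type*} [Finite κ] {s t : Set κ} {j : κ}
    (hj : ¬ (j ∈ s ↔ j ∈ t)) (h : ∀ k, k ≠ j → (k ∈ s ↔ k ∈ t)) :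
    (-1 : ℤ) ^ t.ncard = -(-1) ^ s.ncard := by
  by_cases hs : j ∈ s
  · have ht : j ∉ t := by tauto
    have : s = insert j t := by
      ext k
      by_cases hk : k = j
      · simp [hk, hs]
      · simp [hk, h k hk]
    rw [this, Set.ncard_insert_of_notMem ht, pow_succ]
    ring
  · have ht : j ∈ t := by tauto
    have : t = insert j s := by
      ext k
      by_cases hk : k = j
      · simp [hk, ht]
      · simp [hk, h k hk]
    rw [this, Set.ncard_insert_of_notMem hs, pow_succ]
    ring

open Classical in
/-- The odd-even invariant of a deletion is bounded by the number of topes of the restriction as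
soon as the tope graph has a perfect matching. -/
theorem oddEvenInvariant_deletion_le [Finite ι] [FiniteDimensional ℝ V]
    (A : CentralArrangement ι V) (hA : A.IsDistinct) (i : ι) {M : A.topeGraph.Subgraph}
    (hM : M.IsPerfectMatching) :
    (A.deletion i).oddEvenInvariant ≤ ((A.restriction hA i).topes.ncard : ℤ) := by
  have : Fintype A.topes := A.topes_finite.fintype
  -- The perfect matching read as a fixed-point-free involution on topes.
  choose f hf hfu using fun S : A.topes => hM.1 (hM.2 S)
  have hff : ∀ S, f (f S) = S := fun S => (hfu (f S) S (hf S).symm).symm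
  have hsep := fun S => A.exists_separating_of_adj hA (hf S).adj_sub
  have hbound := abs_sum_union_image_le_card_inter_image
    (fun S : A.topes => i ∈ A.posIndex S) (fun S => (A.deletion i).posIndex S)
    (fun S T hST hi => Subtype.ext (A.injOn_posIndex S.2 T.2 (Set.ext fun j => by
      by_cases hj : j = i
      · rw [hj]
        exact hi
      · exact Set.ext_iff.mp hST ⟨j, hj⟩)))
    (fun t => (-1) ^ t.ncard) (fun t => by simp) f hff (fun S => (hf S).adj_sub.ne') (fun S => by
      obtain ⟨j, hj, hk⟩ := hsep S
      by_cases hji : j = i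
      · left
        exact Set.ext fun k => (hk k (hji ▸ k.2)).symm
      · right
        exact neg_one_pow_ncard_eq_neg (j := ⟨j, hji⟩) hj
          fun k hkj => hk k fun h => hkj (Subtype.ext h))
  have hsum : (A.deletion i).signedOddEvenInvariant =
      ∑ t ∈ (A.deletion i).topes_finite.toFinset.image (A.deletion i).posIndex,
        (-1 : ℤ) ^ t.ncard := by
    rw [Finset.sum_image fun S hS T hT => (A.deletion i).injOn_posIndex (by simpa using hS)
      (by simpa using hT)]
    rfl
  rw [← (A.restriction hA i).injOn_posIndex.ncard_image, oddEvenInvariant, hsum]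
  -- What remains: the union of the two images is the deletion's sign sets, and their intersection
  -- is the restriction's.
  convert hbound using 3
  · ext t
    have := A.mem_image_posIndex_deletion i (t := t)
    simp only [Set.mem_image] at this
    simp only [Finset.mem_image, Set.Finite.mem_toFinset, this, Finset.mem_union,
      Finset.mem_filter, Finset.mem_univ, true_and, Subtype.exists]
    constructor
    · rintro ⟨T, hT, h⟩
      by_cases hi : i ∈ A.posIndex T
      · exact Or.inl ⟨T, hT, hi, h⟩
      · exact Or.inr ⟨T, hT, hi, h⟩
    · rintro (⟨T, hT, -, h⟩ | ⟨T, hT, -, h⟩) <;> exact ⟨T, hT, h⟩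
  · rw [← Set.ncard_coe_finset]
    congr 1
    ext t
    rw [mem_image_posIndex_restriction]
    simp [and_left_comm]

end CentralArrangement

theorem theorem11 {n d : ℕ} (A : CentralArrangement (Fin n) (EuclideanSpace ℝ (Fin d)))
    (hdist : A.IsDistinct) (hsimple : A.IsCentrallySimple) (i : Fin n)
    (hi : (A.deletion i).oddEvenInvariant > 2 * ((A.restriction hdist i).topes.ncard : ℤ)) :
    ¬ ∃ M : A.topeGraph.Subgraph, M.IsPerfectMatching := by
  rintro ⟨M, hM⟩
  have := A.oddEvenInvariant_deletion_le hdist i hM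
  have hnn : (0 : ℤ) ≤ ((A.restriction hdist i).topes.ncard : ℤ) := Int.natCast_nonneg _
  linarith
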